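/- Let $R>0$, let $\Pi=\Pi(R)=\{(x_1,x_2)\in\mathbb{R}^2 : |x_2|\le R\}$, and let $(s_{m,n})_{m,n\in\mathbb{Z}_+}$ be a family of complex numbers, where $\mathbb{Z}_+=\{0,1,2,\dots\}$. The following are equivalent. (i) The two-dimensional moment problem in the strip $\Pi$ has a solution, that is, there is a non-negative Borel measure $\mu$ in $\Pi$ such that all monomials $x_1^m x_2^n$ are $\mu$-integrable and $$\int_\Pi x_1^m x_2^n\,d\mu = s_{m,n},\qquad m,n\in\mathbb{Z}_+.$$ (ii) For all families of complex numbers $(\alpha_{m,n})_{m,n\in\mathbb{Z}_+}$ with only finitely many non-zero members, $$\sum_{m,n,k,l=0}^\infty \alpha_{m,n}\overline{\alpha_{k,l}}\, s_{m+k,n+l}\ \ge\ 0$$ and $$\sum_{m,n,k,l=0}^\infty \alpha_{m,n}\overline{\alpha_{k,l}}\,\bigl(R^2 s_{m+k,n+l}-s_{m+k,n+l+2}\bigr)\ \ge\ 0,$$ where "$\ge 0$" for a complex number means that it is real and non-negative. -/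

import Mathlib

open scoped ComplexOrder ComplexConjugate

/-- The strip of all points `(x₁, x₂)` of the plane with `|x₂| ≤ R`. -/
def strip (R : ℝ) : Set (ℝ × ℝ) := {x | |x.2| ≤ R}

/-- `μ` solves the two-dimensional moment problem in the strip with data `s`: it is a (non-negative)
Borel measure in the strip, i.e. a Borel measure on the plane giving no mass to the complement of
the strip, and for all `m, n` the monomial `x₁ ^ m * x₂ ^ n` is absolutely integrable with integral
`s m n`. (The case `m = n = 0` of integrability says that `μ` is finite.) -/
structure IsStripMomentSolution (R : ℝ) (s : ℕ → ℕ → ℂ) (μ : MeasureTheory.Measure (ℝ × ℝ)) :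
    Prop where
  compl_strip : μ (strip R)ᶜ = 0
  integrable (m n : ℕ) :
    MeasureTheory.IntegrableOn (fun x : ℝ × ℝ => (x.1 : ℂ) ^ m * (x.2 : ℂ) ^ n) (strip R) μ
  moment (m n : ℕ) : ∫ x in strip R, (x.1 : ℂ) ^ m * (x.2 : ℂ) ^ n ∂μ = s m n

/-! Necessity: with a measure at hand, the two sums are integrals of |f|² and of (R² - x₂²)|f|², and
the weight is non-negative on the strip. Sufficiency: by Haviland's theorem it is enough that the
moment functional L is non-negative on every polynomial p that is non-negative on the strip. Rescale
x₂ to t in [0,1] and replace p by its Bernstein approximation in t alone, the sum of p(·, j/N)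
b_{N,j}(t). Each p(·, j/N) is non-negative on the line, hence a sum of two squares, and for even N
each b_{N,j} is, up to a binomial coefficient, a square or t(1-t) times a square. So L is
non-negative on the approximation. The error has size O(1/N) under L, because L(q b_{N,j}) is
dominated by L((1+q²) b_{N,j}) and the b_{N,j} sum to 1. No compactness in x₁ is needed. Now let N
tend to infinity. -/

section Positivity

/-! ### Polynomials non-negative on a strip: two squares and Bernstein approximation -/

open Polynomial

/-- Univariate real polynomials that are non-negative on the line are sums of two squares. -/
theorem Polynomial.exists_sq_add_sq_of_nonneg (p : ℝ[X]) (hp : ∀ x, 0 ≤ p.eval x) :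
    ∃ f g : ℝ[X], p = f ^ 2 + g ^ 2 := by
  induction hn : p.natDegree using Nat.strong_induction_on generalizing p with
  | _ n ih =>
  by_cases hdeg : p.natDegree = 0
  · obtain ⟨c, rfl⟩ := natDegree_eq_zero.1 hdeg
    have hc : 0 ≤ c := by simpa using hp 0
    exact ⟨C (√c), 0, by rw [← C_pow, Real.sq_sqrt hc]; simp⟩
  have hp0 : p ≠ 0 := by rintro rfl; simp at hdeg
  obtain ⟨z, hz⟩ := Complex.exists_root (f := p.map (algebraMap ℝ ℂ)) (by
    rw [degree_map]; exact natDegree_pos_iff_degree_pos.1 (Nat.pos_of_ne_zero hdeg))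
  have hz' : aeval z p = 0 := by rwa [IsRoot, eval_map_algebraMap] at hz
  -- it suffices to split off a sum of two squares that is positive almost everywhere
  have key : ∀ a b : ℝ[X], 0 < (a ^ 2 + b ^ 2).natDegree →
      (a ^ 2 + b ^ 2) ∣ p → ∃ f g : ℝ[X], p = f ^ 2 + g ^ 2 := by
    rintro a b hpos ⟨q, hq⟩
    have hab0 : a ^ 2 + b ^ 2 ≠ 0 := by intro h; simp [h] at hpos
    have hq0 : q ≠ 0 := by rintro rfl; simp at hq; exact hp0 hq
    have hqn : ∀ x, 0 ≤ q.eval x := by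
      -- The sign of `q` is clear off the finitely many zeros of the divisor and extends by
      -- continuity.
      have hd : Dense {x : ℝ | (a ^ 2 + b ^ 2).eval x ≠ 0} := by
        have : {x : ℝ | (a ^ 2 + b ^ 2).eval x ≠ 0} = ((a ^ 2 + b ^ 2).rootSet ℝ)ᶜ := by
          ext x
          simp only [Set.mem_ofPred_eq, Set.mem_compl_iff, mem_rootSet, coe_aeval_eq_eval]
          tauto
        rw [this]
        exact (Set.Finite.countable (rootSet_finite _ _)).dense_compl ℝ
      have hcl : IsClosed {x : ℝ | 0 ≤ q.eval x} := isClosed_le continuous_const q.continuous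
      intro x
      refine hcl.closure_subset_iff.2 ?_ (hd x)
      intro y hy
      have h1 := hp y
      rw [hq, eval_mul] at h1
      have h2 : 0 < (a ^ 2 + b ^ 2).eval y :=
        lt_of_le_of_ne (by simp only [eval_add, eval_pow]; positivity) (Ne.symm hy)
      exact nonneg_of_mul_nonneg_right h1 h2
    have hlt : q.natDegree < n := by
      rw [← hn, hq, natDegree_mul hab0 hq0]; omega
    obtain ⟨f, g, hfg⟩ := ih _ hlt q hqn rfl
    exact ⟨a * f - b * g, a * g + b * f, by rw [hq, hfg]; ring⟩
  -- A real root is a minimum, hence at least double; a non-real root comes with its conjugate.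
  by_cases him : z.im = 0
  · have hroot : p.IsRoot z.re := by
      have : z = (z.re : ℂ) := Complex.ext rfl (by simp [him])
      rw [this, ← Complex.coe_algebraMap, aeval_algebraMap_apply] at hz'
      simpa using hz'
    have hder : p.derivative.IsRoot z.re := by
      have hmin : IsLocalMin (fun x => p.eval x) z.re :=
        Filter.Eventually.of_forall fun x => by
          show p.eval z.re ≤ p.eval x
          rw [hroot.eq_zero]; exact hp x
      exact hmin.hasDerivAt_eq_zero (p.hasDerivAt z.re)
    have h2 : 1 < p.rootMultiplicity z.re :=
      (one_lt_rootMultiplicity_iff_isRoot hp0).2 ⟨hroot, hder⟩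
    refine key (X - C z.re) 0 ?_ ?_
    · simp [natDegree_pow]
    · simpa using (le_rootMultiplicity_iff hp0).1 h2
  · have hd := p.quadratic_dvd_of_aeval_eq_zero_im_ne_zero hz' him
    have he : (X - C z.re) ^ 2 + (C z.im) ^ 2 = X ^ 2 - C (2 * z.re) * X + C (‖z‖ ^ 2) := by
      rw [← Complex.normSq_eq_norm_sq, Complex.normSq_apply]
      simp only [map_mul, map_add, C_ofNat]
      ring
    refine key (X - C z.re) (C z.im) ?_ (he ▸ hd)
    rw [← C_pow, natDegree_add_C]
    simp [natDegree_pow]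

/-- The Bernstein expansion of a monomial. -/
theorem bernsteinPolynomial.sum_descFactorial {S : Type*} [CommRing S] (N k : ℕ) (hk : k ≤ N) :
    ∑ j ∈ Finset.range (N + 1), j.descFactorial k • bernsteinPolynomial S N j =
      N.descFactorial k • (X : S[X]) ^ k := by
  have h1 : ∀ j ∈ Finset.range (N + 1), j ∉ Finset.Ico k (N + 1) →
      j.descFactorial k • bernsteinPolynomial S N j = 0 := by
    intro j hj hj'
    have : j < k := by simp at hj hj'; omega
    simp [Nat.descFactorial_of_lt this]
  rw [← Finset.sum_subset (fun j hj => by simp at hj ⊢; omega) h1, Finset.sum_Ico_eq_sum_range]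
  have h2 : ∀ i ∈ Finset.range (N + 1 - k),
      (k + i).descFactorial k • bernsteinPolynomial S N (k + i) =
        (N.descFactorial k • (X : S[X]) ^ k) *
          (X ^ i * (1 - X) ^ (N - k - i) * ((N - k).choose i : S[X])) := by
    intro i hi
    have hc : (k + i).descFactorial k * N.choose (k + i) =
        N.descFactorial k * (N - k).choose i := by
      have := Nat.choose_mul (n := N) (k := k + i) (s := k) (by omega)
      rw [Nat.descFactorial_eq_factorial_mul_choose, Nat.descFactorial_eq_factorial_mul_choose]
      rw [Nat.add_sub_cancel_left] at this
      linear_combination k.factorial * this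
    have hc' : (((k + i).descFactorial k : S[X]) * (N.choose (k + i) : S[X])) =
        (N.descFactorial k : S[X]) * ((N - k).choose i : S[X]) := mod_cast congrArg (Nat.cast) hc
    rw [bernsteinPolynomial, nsmul_eq_mul, nsmul_eq_mul, show N - (k + i) = N - k - i by omega,
      pow_add]
    linear_combination (X ^ k * X ^ i * (1 - X) ^ (N - k - i)) * hc'
  rw [Finset.sum_congr rfl h2, ← Finset.mul_sum, show N + 1 - k = N - k + 1 by omega, ← add_pow]
  simp

/-- Both terms are products of k factors in [0,1]; the factors (j-i)/(N-i) and j/N differ by at most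
i/N, and these errors add up. -/
theorem abs_descFactorial_div_sub_pow_le (N j k : ℕ) (hj : j ≤ N) (hk : k ≤ N) :
    |(j.descFactorial k : ℝ) / N.descFactorial k - ((j : ℝ) / N) ^ k| ≤ (k : ℝ) ^ 2 / N := by
  induction k with
  | zero => simp
  | succ k ih =>
    have ih := ih (by omega)
    have hN : (0 : ℝ) < N := by exact_mod_cast (by omega : 0 < N)
    have hNk : (0 : ℝ) < (N - k : ℕ) := by exact_mod_cast (by omega : 0 < N - k)
    have hjN : (j : ℝ) ≤ N := by exact_mod_cast hj
    set a : ℝ := ((j - k : ℕ) : ℝ) / (N - k : ℕ) with ha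
    set b : ℝ := (j : ℝ) / N with hb
    have ha0 : 0 ≤ a := by positivity
    have ha1 : a ≤ 1 := by
      rw [ha, div_le_one hNk]; exact_mod_cast (by omega : j - k ≤ N - k)
    have hb0 : 0 ≤ b := by positivity
    have hb1 : b ≤ 1 := by rw [hb, div_le_one hN]; exact hjN
    have hab : |a - b| ≤ (k : ℝ) / N := by
      by_cases hjk : j < k
      · have : a = 0 := by rw [ha, Nat.sub_eq_zero_of_le hjk.le]; simp
        rw [this, zero_sub, abs_neg, abs_of_nonneg hb0, hb]
        gcongr
      · push Not at hjk
        have e : a - b = -((k / N : ℝ) * (((N : ℝ) - j) / (N - k : ℕ))) := by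
          rw [ha, hb]
          have : ((N - k : ℕ) : ℝ) = N - k := by rw [Nat.cast_sub (by omega)]
          rw [Nat.cast_sub hjk]
          field_simp
          rw [this]; ring
        rw [e, abs_neg, abs_of_nonneg (by
          apply mul_nonneg (by positivity) (div_nonneg (by linarith) hNk.le))]
        refine mul_le_of_le_one_right (by positivity) ?_
        rw [div_le_one hNk, Nat.cast_sub (by omega)]
        have : (k : ℝ) ≤ j := by exact_mod_cast hjk
        linarith
    have hr : ((j.descFactorial (k + 1) : ℝ) / N.descFactorial (k + 1)) =
        a * ((j.descFactorial k : ℝ) / N.descFactorial k) := by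
      rw [Nat.descFactorial_succ, Nat.descFactorial_succ, ha]
      push_cast
      rw [mul_div_mul_comm]
    set r : ℝ := (j.descFactorial k : ℝ) / N.descFactorial k
    have hbk : b ^ k ≤ 1 := pow_le_one₀ hb0 hb1
    have hbk0 : 0 ≤ b ^ k := by positivity
    calc |(j.descFactorial (k + 1) : ℝ) / N.descFactorial (k + 1) - b ^ (k + 1)|
        = |a * (r - b ^ k) + (a - b) * b ^ k| := by rw [hr]; congr 1; ring
      _ ≤ |a * (r - b ^ k)| + |(a - b) * b ^ k| := abs_add_le _ _
      _ = a * |r - b ^ k| + |a - b| * b ^ k := by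
        rw [abs_mul, abs_mul, abs_of_nonneg ha0, abs_of_nonneg hbk0]
      _ ≤ 1 * ((k : ℝ) ^ 2 / N) + (k / N) * 1 := by gcongr
      _ ≤ ((k + 1 : ℕ) : ℝ) ^ 2 / N := by
        push_cast
        rw [one_mul, mul_one, ← add_div]
        gcongr
        nlinarith

section BernsteinPositivity

variable {L : ℝ[X][X] →ₗ[ℝ] ℝ}

/-- For even N the exponents j and N - j have the same parity: both even gives a square, both odd
leaves one factor X(1 - X). -/
theorem map_sq_mul_bernsteinPolynomial_nonneg (hsq : ∀ f, 0 ≤ L (f ^ 2))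
    (hX : ∀ f, 0 ≤ L (X * (1 - X) * f ^ 2)) {N : ℕ} (hN : Even N) (j : ℕ) (g : ℝ[X][X]) :
    0 ≤ L (g ^ 2 * bernsteinPolynomial ℝ[X] N j) := by
  by_cases hj : N < j
  · simp [bernsteinPolynomial.eq_zero_of_lt _ hj]
  push Not at hj
  have hcast : ∀ h : ℝ[X][X], L ((N.choose j : ℝ[X][X]) * h) = N.choose j * L h := by
    intro h; rw [← nsmul_eq_mul, map_nsmul, nsmul_eq_mul]
  rcases Nat.even_or_odd' j with ⟨a, rfl | rfl⟩
  · obtain ⟨b, hb⟩ : ∃ b, N - 2 * a = 2 * b := by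
      obtain ⟨c, hc⟩ := hN; exact ⟨c - a, by omega⟩
    have : g ^ 2 * bernsteinPolynomial ℝ[X] N (2 * a) =
        (N.choose (2 * a) : ℝ[X][X]) * (g * X ^ a * (1 - X) ^ b) ^ 2 := by
      rw [bernsteinPolynomial, hb]; ring
    rw [this, hcast]
    exact mul_nonneg (Nat.cast_nonneg _) (hsq _)
  · obtain ⟨b, hb⟩ : ∃ b, N - (2 * a + 1) = 2 * b + 1 := by
      obtain ⟨c, hc⟩ := hN; exact ⟨c - a - 1, by omega⟩
    have : g ^ 2 * bernsteinPolynomial ℝ[X] N (2 * a + 1) =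
        (N.choose (2 * a + 1) : ℝ[X][X]) * (X * (1 - X) * (g * X ^ a * (1 - X) ^ b) ^ 2) := by
      rw [bernsteinPolynomial, hb]; ring
    rw [this, hcast]
    exact mul_nonneg (Nat.cast_nonneg _) (hX _)

theorem map_C_mul_bernsteinPolynomial_nonneg (hsq : ∀ f, 0 ≤ L (f ^ 2))
    (hX : ∀ f, 0 ≤ L (X * (1 - X) * f ^ 2)) {N : ℕ} (hN : Even N) (j : ℕ) {q : ℝ[X]}
    (hq : ∀ x, 0 ≤ q.eval x) : 0 ≤ L (C q * bernsteinPolynomial ℝ[X] N j) := by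
  obtain ⟨f, g, rfl⟩ := q.exists_sq_add_sq_of_nonneg hq
  rw [map_add, add_mul, map_add, C_pow, C_pow]
  exact add_nonneg (map_sq_mul_bernsteinPolynomial_nonneg hsq hX hN j _)
    (map_sq_mul_bernsteinPolynomial_nonneg hsq hX hN j _)

/-- Both 1 + q² + q and 1 + q² - q are non-negative. This controls coefficients of arbitrary sign by
a bound that can be summed over j. -/
theorem abs_map_C_mul_bernsteinPolynomial_le (hsq : ∀ f, 0 ≤ L (f ^ 2))
    (hX : ∀ f, 0 ≤ L (X * (1 - X) * f ^ 2)) {N : ℕ} (hN : Even N) (j : ℕ) (q : ℝ[X]) :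
    |L (C q * bernsteinPolynomial ℝ[X] N j)| ≤
      L (C (1 + q ^ 2) * bernsteinPolynomial ℝ[X] N j) := by
  have h1 := map_C_mul_bernsteinPolynomial_nonneg hsq hX hN j (q := 1 + q ^ 2 + q) fun x => by
    simp only [eval_add, eval_one, eval_pow]; nlinarith [sq_nonneg (q.eval x + 1)]
  have h2 := map_C_mul_bernsteinPolynomial_nonneg hsq hX hN j (q := 1 + q ^ 2 - q) fun x => by
    simp only [eval_add, eval_sub, eval_one, eval_pow]; nlinarith [sq_nonneg (q.eval x - 1)]
  rw [C_add, add_mul, map_add] at h1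
  rw [C_sub, sub_mul, map_sub] at h2
  rw [abs_le]
  constructor <;> linarith

/-- Lower bound obtained by comparing a polynomial with its Bernstein approximation. -/
theorem neg_le_map_of_nonneg_on_unitStrip (hsq : ∀ f, 0 ≤ L (f ^ 2))
    (hX : ∀ f, 0 ≤ L (X * (1 - X) * f ^ 2)) {p : ℝ[X][X]}
    (hp : ∀ x t : ℝ, 0 ≤ t → t ≤ 1 → 0 ≤ (p.eval (C t)).eval x) {N : ℕ} (hN : Even N)
    (hN0 : 0 < N) (hpN : p.natDegree ≤ N) :
    -((∑ k ∈ Finset.range (p.natDegree + 1), (k : ℝ) ^ 2 * L (C (1 + p.coeff k ^ 2))) / N) ≤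
      L p := by
  set b : ℕ → ℝ[X][X] := bernsteinPolynomial ℝ[X] N with hb
  set K := Finset.range (p.natDegree + 1)
  set J := Finset.range (N + 1)
  have hmono : ∀ k ∈ K, ∀ q : ℝ[X],
      L (C q * X ^ k) = ∑ j ∈ J, (j.descFactorial k : ℝ) / N.descFactorial k * L (C q * b j) := by
    intro k hk q
    have hkN : k ≤ N := by simp [K] at hk; omega
    have hpos : (0 : ℝ) < N.descFactorial k := by
      exact_mod_cast Nat.descFactorial_pos.2 hkN
    have h := congrArg (fun r => L (C q * r)) 
      (bernsteinPolynomial.sum_descFactorial (S := ℝ[X]) N k hkN)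
    simp only [Finset.mul_sum, map_sum, mul_smul_comm, map_nsmul] at h
    simp only [nsmul_eq_mul] at h
    simp only [div_mul_eq_mul_div, ← Finset.sum_div]
    rw [eq_div_iff hpos.ne', mul_comm, ← h]
  have hLp : L p = ∑ k ∈ K, ∑ j ∈ J,
      (j.descFactorial k : ℝ) / N.descFactorial k * L (C (p.coeff k) * b j) := by
    conv_lhs => rw [p.as_sum_range_C_mul_X_pow, map_sum]
    exact Finset.sum_congr rfl fun k hk => hmono k hk _
  -- This double sum is L of the Bernstein approximation, regrouped by nodes j/N.
  have hB : 0 ≤ ∑ k ∈ K, ∑ j ∈ J, ((j : ℝ) / N) ^ k * L (C (p.coeff k) * b j) := by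
    rw [Finset.sum_comm]
    refine Finset.sum_nonneg fun j hj => ?_
    have hjN : j ≤ N := by simp [J] at hj; omega
    have : ∑ k ∈ K, ((j : ℝ) / N) ^ k * L (C (p.coeff k) * b j) =
        L (C (p.eval (C ((j : ℝ) / N))) * b j) := by
      rw [eval_eq_sum_range, map_sum, Finset.sum_mul, map_sum]
      refine Finset.sum_congr rfl fun k _ => ?_
      rw [← smul_eq_mul, ← map_smul]
      congr 1
      rw [← C_pow, mul_comm (p.coeff k), ← smul_eq_C_mul (((j : ℝ) / N) ^ k), ← smul_C,
        smul_mul_assoc]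
    rw [this]
    refine map_C_mul_bernsteinPolynomial_nonneg hsq hX hN j fun x => hp x _ (by positivity) ?_
    exact div_le_one_of_le₀ (by exact_mod_cast hjN) (by positivity)
  have hone : ∀ q : ℝ[X], ∑ j ∈ J, L (C q * b j) = L (C q) := by
    intro q
    rw [← map_sum, ← Finset.mul_sum, bernsteinPolynomial.sum, mul_one]
  have hdiff : |L p - ∑ k ∈ K, ∑ j ∈ J, ((j : ℝ) / N) ^ k * L (C (p.coeff k) * b j)| ≤
      (∑ k ∈ K, (k : ℝ) ^ 2 * L (C (1 + p.coeff k ^ 2))) / N := by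
    rw [hLp, ← Finset.sum_sub_distrib, Finset.sum_div]
    refine (Finset.abs_sum_le_sum_abs _ _).trans (Finset.sum_le_sum fun k hk => ?_)
    have hkN : k ≤ N := by simp [K] at hk; omega
    -- Partition of unity: the bound is spread over j, so its total does not grow with N.
    rw [← Finset.sum_sub_distrib, ← hone, mul_div_right_comm, Finset.mul_sum]
    refine (Finset.abs_sum_le_sum_abs _ _).trans (Finset.sum_le_sum fun j hj => ?_)
    have hjN : j ≤ N := by simp [J] at hj; omega
    rw [← sub_mul, abs_mul]
    exact mul_le_mul (abs_descFactorial_div_sub_pow_le N j k hjN hkN)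
      (abs_map_C_mul_bernsteinPolynomial_le hsq hX hN j _) (abs_nonneg _) (by positivity)
  linarith [abs_le.1 hdiff]

/-- A functional that is non-negative on the squares and on the squares times `X * (1 - X)` is
non-negative on all polynomials that are non-negative on the strip `ℝ × [0, 1]`. -/
theorem map_nonneg_of_nonneg_on_unitStrip (hsq : ∀ f, 0 ≤ L (f ^ 2))
    (hX : ∀ f, 0 ≤ L (X * (1 - X) * f ^ 2)) {p : ℝ[X][X]}
    (hp : ∀ x t : ℝ, 0 ≤ t → t ≤ 1 → 0 ≤ (p.eval (C t)).eval x) : 0 ≤ L p := by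
  set c := ∑ k ∈ Finset.range (p.natDegree + 1), (k : ℝ) ^ 2 * L (C (1 + p.coeff k ^ 2))
  have hlim : Filter.Tendsto (fun n : ℕ => -(c / ((2 * (n + 1) : ℕ) : ℝ))) Filter.atTop
      (nhds 0) := by
    rw [← neg_zero]
    refine Filter.Tendsto.neg (Filter.Tendsto.div_atTop tendsto_const_nhds ?_)
    refine tendsto_natCast_atTop_atTop.comp (Filter.tendsto_atTop_mono (fun n => ?_)
      Filter.tendsto_id)
    simp only [id]; omega
  refine le_of_tendsto hlim ?_
  filter_upwards [Filter.eventually_ge_atTop p.natDegree] with n hn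
  exact neg_le_map_of_nonneg_on_unitStrip hsq hX hp (even_two_mul _) (by omega) (by omega)

end BernsteinPositivity

/-- The affine map u = (X + R)/(2R), with inverse v, carries [-R, R] to [0,1], and u(1 - u) = (R² -
X²)/(2R)². -/
theorem map_nonneg_of_nonneg_on_strip {L : ℝ[X][X] →ₗ[ℝ] ℝ} {R : ℝ} (hR : 0 < R)
    (hsq : ∀ f, 0 ≤ L (f ^ 2)) (hX : ∀ f, 0 ≤ L ((C (C (R ^ 2)) - X ^ 2) * f ^ 2)) {p : ℝ[X][X]}
    (hp : ∀ x t : ℝ, |t| ≤ R → 0 ≤ (p.eval (C t)).eval x) : 0 ≤ L p := by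
  have h2R : 2 * R * (2 * R)⁻¹ = 1 := mul_inv_cancel₀ (by positivity)
  set u : ℝ[X][X] := C (C (2 * R)⁻¹) * (X + C (C R)) with hu
  set v : ℝ[X][X] := C (C (2 * R)) * X - C (C R) with hv
  have huv : v.comp u = X := by
    simp only [hv, hu, sub_comp, mul_comp, C_comp, X_comp]
    rw [← mul_assoc, ← C_mul, ← C_mul, h2R]; simp
  have hu1 : u * (1 - u) = C (C ((2 * R)⁻¹ ^ 2)) * (C (C (R ^ 2)) - X ^ 2) := by
    have e : C (C R) * C (C (2 * R)⁻¹) * 2 = (1 : ℝ[X][X]) := by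
      have : (2 : ℝ[X][X]) = C (C 2) := rfl
      rw [this, ← C_mul, ← C_mul, ← C_mul, ← C_mul, mul_right_comm, mul_comm R, h2R]; simp
    simp only [hu, map_pow]
    linear_combination (-C (C (2 * R)⁻¹) * (X + C (C R))) * e
  let φ : ℝ[X][X] →ₗ[ℝ] ℝ[X][X] :=
    { toFun := fun q => q.comp u
      map_add' := fun a b => by simp
      map_smul' := fun a b => smul_comp a b u }
  have hφ : ∀ q, (L.comp φ) q = L (q.comp u) := fun q => rfl
  have := map_nonneg_of_nonneg_on_unitStrip (L := L.comp φ) (p := p.comp v) ?_ ?_ ?_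
  · rwa [hφ, comp_assoc, huv, comp_X] at this
  · intro f; rw [hφ, pow_comp]; exact hsq _
  · intro f
    rw [hφ]
    have : (X * (1 - X) * f ^ 2).comp u =
        (C (C (R ^ 2)) - X ^ 2) * (C (C (2 * R)⁻¹) * f.comp u) ^ 2 := by
      simp only [mul_comp, sub_comp, X_comp, one_comp, pow_comp]
      rw [hu1, map_pow, map_pow]; ring
    rw [this]
    exact hX _
  · intro x t h0 h1
    have : (p.comp v).eval (C t) = p.eval (C (2 * R * t - R)) := by
      rw [eval_comp]; congr 1; simp [hv]
    rw [this]
    refine hp _ _ (abs_le.2 ⟨?_, ?_⟩) <;> nlinarith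

end Positivity

/-! ### Haviland's theorem via Riesz extension and Riesz–Markov–Kakutani -/

section Haviland

open MeasureTheory Filter Topology
open scoped CompactlySupported

variable {X A : Type*} [TopologicalSpace X] [CommRing A] [Algebra ℝ A]

/-- The continuous functions dominated by a function in the range of `φ`. -/
def dominatedSubmodule (φ : A →ₐ[ℝ] C(X, ℝ)) : Submodule ℝ C(X, ℝ) where
  carrier := {f | ∃ a, ∀ x, |f x| ≤ φ a x}
  add_mem' := by
    rintro f g ⟨a, ha⟩ ⟨b, hb⟩
    exact ⟨a + b, fun x => (abs_add_le _ _).trans (by simpa using add_le_add (ha x) (hb x))⟩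
  zero_mem' := ⟨0, fun x => by simp⟩
  smul_mem' := by
    rintro c f ⟨a, ha⟩
    exact ⟨|c| • a, fun x => by
      simpa [abs_mul] using mul_le_mul_of_nonneg_left (ha x) (abs_nonneg c)⟩

variable {φ : A →ₐ[ℝ] C(X, ℝ)}

theorem mem_dominatedSubmodule {f : C(X, ℝ)} :
    f ∈ dominatedSubmodule φ ↔ ∃ a, ∀ x, |f x| ≤ φ a x := Iff.rfl

theorem apply_mem_dominatedSubmodule (a : A) : φ a ∈ dominatedSubmodule φ := by
  refine ⟨1 + a ^ 2, fun x => ?_⟩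
  simp only [map_add, map_one, map_pow, ContinuousMap.add_apply, ContinuousMap.one_apply,
    ContinuousMap.pow_apply]
  rw [abs_le]
  constructor <;> nlinarith [sq_nonneg (φ a x - 1), sq_nonneg (φ a x + 1)]

/-- A positive functional extends to a positive functional on the dominated functions. -/
theorem exists_positive_extension {L : A →ₗ[ℝ] ℝ} (hL : ∀ a, (∀ x, 0 ≤ φ a x) → 0 ≤ L a) :
    ∃ g : dominatedSubmodule φ →ₗ[ℝ] ℝ,
      (∀ a, g ⟨φ a, apply_mem_dominatedSubmodule a⟩ = L a) ∧
      ∀ f : dominatedSubmodule φ, (∀ x, 0 ≤ f.1 x) → 0 ≤ g f := by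
  let ψ : A →ₗ[ℝ] dominatedSubmodule φ :=
    φ.toLinearMap.codRestrict _ fun a => apply_mem_dominatedSubmodule a
  have hψ : ∀ a, (ψ a).1 = φ a := fun a => rfl
  -- φ need not be injective; positivity makes L depend only on `φ a`.
  have hwell : ∀ a b, φ a = φ b → L a = L b := by
    intro a b hab
    apply le_antisymm
    · have := hL (b - a) fun x => by simp [hab]
      rw [map_sub] at this; linarith
    · have := hL (a - b) fun x => by simp [hab]
      rw [map_sub] at this; linarith
  choose σ hσ using fun y : LinearMap.range ψ => LinearMap.mem_range.1 y.2
  have hσ' : ∀ y, φ (σ y) = y.1.1 := fun y => by rw [← hψ, hσ]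
  let f : LinearMap.range ψ →ₗ[ℝ] ℝ :=
    { toFun := fun y => L (σ y)
      map_add' := fun y z => by
        rw [← map_add]; apply hwell; rw [map_add, hσ', hσ', hσ']; rfl
      map_smul' := fun c y => by
        rw [← map_smul]; apply hwell; rw [map_smul, hσ', hσ']; rfl }
  let s : PointedCone ℝ (dominatedSubmodule φ) :=
    { carrier := {f | ∀ x, 0 ≤ f.1 x}
      add_mem' := fun {f g} hf hg x => add_nonneg (hf x) (hg x)
      zero_mem' := fun x => le_rfl
      smul_mem' := fun c f hf x => mul_nonneg c.2 (hf x) }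
  obtain ⟨g, hg1, hg2⟩ := riesz_extension s ⟨LinearMap.range ψ, f⟩
    (fun y hy => hL _ fun x => by rw [hσ']; exact hy x) (fun y => by
      obtain ⟨a, ha⟩ := y.2
      refine ⟨⟨ψ a, a, rfl⟩, fun x => ?_⟩
      have := abs_le.1 (ha x)
      show 0 ≤ φ a x + y.1 x
      linarith)
  refine ⟨g, fun a => ?_, fun f hf => hg2 f hf⟩
  exact (hg1 ⟨ψ a, a, rfl⟩).trans (hwell _ _ (hσ' ⟨ψ a, a, rfl⟩))

theorem compactlySupported_mem_dominatedSubmodule (f : C_c(X, ℝ)) :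
    (f : C(X, ℝ)) ∈ dominatedSubmodule φ := by
  obtain ⟨c, hc⟩ := f.hasCompactSupport.exists_bound_of_continuous f.continuous
  refine ⟨algebraMap ℝ A c, fun x => ?_⟩
  rw [AlgHom.commutes]
  exact hc x

/-- **Haviland's theorem**: a linear functional on an algebra of continuous functions containing
a non-negative proper function, which is non-negative on non-negative functions, is represented by
a measure. -/
theorem exists_measure_integral_eq [T2Space X] [LocallyCompactSpace X] [MeasurableSpace X]
    [BorelSpace X] {h : A} (h0 : ∀ x, 0 ≤ φ h x) (hh : ∀ c : ℝ, IsCompact {x | φ h x ≤ c})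
    {L : A →ₗ[ℝ] ℝ} (hL : ∀ a, (∀ x, 0 ≤ φ a x) → 0 ≤ L a) :
    ∃ μ : Measure X, ∀ a, Integrable (φ a) μ ∧ ∫ x, φ a x ∂μ = L a := by
  obtain ⟨g, hg1, hg2⟩ := exists_positive_extension hL
  let ι : C_c(X, ℝ) →ₗ[ℝ] dominatedSubmodule φ :=
    { toFun := fun f => ⟨f, compactlySupported_mem_dominatedSubmodule f⟩
      map_add' := fun _ _ => rfl
      map_smul' := fun _ _ => rfl }
  let Λ : C_c(X, ℝ) →ₚ[ℝ] ℝ := PositiveLinearMap.mk₀ (g.comp ι) fun f hf => hg2 _ fun x => hf x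
  let μ := RealRMK.rieszMeasure Λ
  -- truncation of a continuous function
  have hcut : ∀ (n : ℕ) (f : C(X, ℝ)), HasCompactSupport
      fun x => max 0 (min 1 (n + 1 - φ h x)) * f x := fun n f =>
    HasCompactSupport.intro (hh (n + 1)) fun x hx => by
      have : (n : ℝ) + 1 < φ h x := by simpa using hx
      rw [max_eq_left ((min_le_right _ _).trans (by linarith)), zero_mul]
  let χ : ℕ → C(X, ℝ) → C_c(X, ℝ) := fun n f =>
    ⟨⟨fun x => max 0 (min 1 (n + 1 - φ h x)) * f x, by fun_prop⟩, hcut n f⟩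
  have hχ : ∀ n f x, χ n f x = max 0 (min 1 (n + 1 - φ h x)) * f x := fun _ _ _ => rfl
  have hc0 : ∀ (n : ℕ) x, 0 ≤ max 0 (min 1 (n + 1 - φ h x)) := fun n x => le_max_left _ _
  have hc1 : ∀ (n : ℕ) x, max 0 (min 1 (n + 1 - φ h x)) ≤ 1 := fun n x =>
    max_le zero_le_one (min_le_left _ _)
  have hΛ : ∀ f, ∫ x, f x ∂μ = g (ι f) := fun f => RealRMK.integral_rieszMeasure Λ f
  have key : ∀ a, (∀ x, 0 ≤ φ a x) → Integrable (φ a) μ ∧ ∫ x, φ a x ∂μ = L a := by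
    intro a ha
    have hup : ∀ n, ∫ x, χ n (φ a) x ∂μ ≤ L a := by
      intro n
      rw [hΛ, ← hg1, ← sub_nonneg, ← map_sub]
      refine hg2 _ fun x => ?_
      show 0 ≤ φ a x - max 0 (min 1 (n + 1 - φ h x)) * φ a x
      nlinarith [hc1 n x, ha x]
    -- No mass escapes to infinity: the cutoff is at least 1 - h/(n+1).
    have hlow : ∀ n : ℕ, L a - L (h * a) / (n + 1) ≤ ∫ x, χ n (φ a) x ∂μ := by
      intro n
      have : L a - L (h * a) / (n + 1) = L (a - ((n : ℝ) + 1)⁻¹ • (h * a)) := by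
        rw [map_sub, map_smul, smul_eq_mul, div_eq_inv_mul]
      rw [hΛ, this, ← hg1, ← sub_nonneg, ← map_sub]
      refine hg2 _ fun x => ?_
      show 0 ≤ max 0 (min 1 (n + 1 - φ h x)) * φ a x - φ (a - ((n : ℝ) + 1)⁻¹ • (h * a)) x
      have : φ (a - ((n : ℝ) + 1)⁻¹ • (h * a)) x = (1 - ((n : ℝ) + 1)⁻¹ * φ h x) * φ a x := by
        simp; ring
      rw [this, ← sub_mul]
      refine mul_nonneg (sub_nonneg.2 ?_) (ha x)
      have hn : (0 : ℝ) < n + 1 := by positivity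
      have e : 1 - ((n : ℝ) + 1)⁻¹ * φ h x = ((n : ℝ) + 1)⁻¹ * (n + 1 - φ h x) := by
        field_simp
      rcases le_total ((n : ℝ) + 1 - φ h x) 0 with hx | hx
      · refine le_max_of_le_left ?_
        rw [e]; exact mul_nonpos_of_nonneg_of_nonpos (by positivity) hx
      · refine le_max_of_le_right (le_min ?_ ?_)
        · have := h0 x
          have : 0 ≤ ((n : ℝ) + 1)⁻¹ * φ h x := by positivity
          linarith
        · rw [e]
          refine mul_le_of_le_one_left hx (inv_le_one_of_one_le₀ ?_)
          linarith [(Nat.cast_nonneg n : (0 : ℝ) ≤ n)]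
    have hlim : Tendsto (fun n => ∫ x, χ n (φ a) x ∂μ) atTop (𝓝 (L a)) := by
      refine tendsto_of_tendsto_of_tendsto_of_le_of_le ?_ tendsto_const_nhds hlow hup
      have h1 : Tendsto (fun n : ℕ => L (h * a) / ((n : ℝ) + 1)) atTop (𝓝 0) :=
        tendsto_const_nhds.div_atTop
          (tendsto_atTop_add_const_right _ _ tendsto_natCast_atTop_atTop)
      simpa using tendsto_const_nhds.sub h1
    have hpt : ∀ x, Tendsto (fun n => χ n (φ a) x) atTop (𝓝 (φ a x)) := by
      intro x
      refine tendsto_const_nhds.congr' ?_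
      filter_upwards [eventually_ge_atTop ⌈φ h x⌉₊] with n hn
      have : φ h x ≤ n := Nat.ceil_le.1 hn
      rw [hχ, min_eq_left (by linarith), max_eq_right zero_le_one, one_mul]
    have hpos : ∀ n x, 0 ≤ χ n (φ a) x := fun n x => mul_nonneg (hc0 n x) (ha x)
    have hint : ∀ n, Integrable (fun x => χ n (φ a) x) μ := fun n =>
      (χ n (φ a)).continuous.integrable_of_hasCompactSupport (χ n (φ a)).hasCompactSupport
    have hmeas : AEStronglyMeasurable (φ a) μ :=
      aestronglyMeasurable_of_tendsto_ae atTop (fun n => (hint n).aestronglyMeasurable)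
        (ae_of_all _ hpt)
    have hfin : Integrable (φ a) μ := by
      refine ⟨hmeas, lt_of_le_of_lt ?_ (ENNReal.ofReal_lt_top (r := L a))⟩
      -- Fatou's lemma gives integrability, which then serves as the dominating bound.
      calc ∫⁻ x, ‖φ a x‖ₑ ∂μ ≤ liminf (fun n => ∫⁻ x, ‖χ n (φ a) x‖ₑ ∂μ) atTop := by
            rw [lintegral_congr fun x => ((hpt x).enorm.liminf_eq).symm]
            exact lintegral_liminf_le' fun n => (hint n).aestronglyMeasurable.enorm
        _ ≤ ENNReal.ofReal (L a) := by
            refine liminf_le_of_frequently_le' (Frequently.of_forall fun n => ?_)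
            have : ∀ x, ‖χ n (φ a) x‖ₑ = ENNReal.ofReal (χ n (φ a) x) := fun x =>
              Real.enorm_of_nonneg (hpos n x)
            rw [lintegral_congr this, ← ofReal_integral_eq_lintegral_ofReal (hint n)
              (ae_of_all _ (hpos n))]
            exact ENNReal.ofReal_le_ofReal (hup n)
    refine ⟨hfin, tendsto_nhds_unique ?_ hlim⟩
    refine tendsto_integral_of_dominated_convergence (φ a) (fun n => (hint n).aestronglyMeasurable)
      hfin (fun n => ae_of_all _ fun x => ?_) (ae_of_all _ hpt)
    rw [Real.norm_of_nonneg (hpos n x), hχ]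
    exact mul_le_of_le_one_left (ha x) (hc1 n x)
  refine ⟨μ, fun a => ?_⟩
  -- Polarization, 4a = (a+1)² - (a-1)², reduces to non-negative functions.
  obtain ⟨i1, e1⟩ := key ((a + 1) ^ 2) fun x => by simp; positivity
  obtain ⟨i2, e2⟩ := key ((a - 1) ^ 2) fun x => by
    simp only [map_pow, ContinuousMap.pow_apply]; positivity
  have hfun : ∀ x, φ a x = (1 / 4 : ℝ) * (φ ((a + 1) ^ 2) x - φ ((a - 1) ^ 2) x) := fun x => by
    simp; ring
  have hLa : L a = (1 / 4 : ℝ) * (L ((a + 1) ^ 2) - L ((a - 1) ^ 2)) := by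
    have : (a + 1) ^ 2 - (a - 1) ^ 2 = (4 : ℝ) • a := by
      rw [Algebra.smul_def, map_ofNat]; ring
    rw [← map_sub, this, map_smul, smul_eq_mul]; ring
  refine ⟨((i1.sub i2).const_mul (1 / 4)).congr (ae_of_all _ fun x => (hfun x).symm), ?_⟩
  rw [integral_congr_ae (ae_of_all _ hfun), integral_const_mul, integral_sub i1 i2, e1, e2, hLa]

end Haviland

/-! ### Positivity from a representing measure -/

section Necessity

open MeasureTheory

theorem sum_mul_conj_mul_nonneg_of_integral {μ : Measure (ℝ × ℝ)} {w : ℝ × ℝ → ℝ}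
    (hw : ∀ᵐ x ∂μ, 0 ≤ w x) {s : ℕ → ℕ → ℂ}
    (hi : ∀ m n, Integrable (fun x : ℝ × ℝ => (w x : ℂ) * ((x.1 : ℂ) ^ m * (x.2 : ℂ) ^ n)) μ)
    (hs : ∀ m n, ∫ x, (w x : ℂ) * ((x.1 : ℂ) ^ m * (x.2 : ℂ) ^ n) ∂μ = s m n)
    (α : ℕ × ℕ →₀ ℂ) :
    0 ≤ ∑ p ∈ α.support, ∑ q ∈ α.support, α p * conj (α q) * s (p.1 + q.1) (p.2 + q.2) := by
  have h : ∑ p ∈ α.support, ∑ q ∈ α.support, α p * conj (α q) * s (p.1 + q.1) (p.2 + q.2) =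
      ∫ x, ((w x * ‖∑ p ∈ α.support, α p * ((x.1 : ℂ) ^ p.1 * (x.2 : ℂ) ^ p.2)‖ ^ 2 : ℝ) : ℂ)
        ∂μ := by
    simp only [← hs, ← integral_const_mul]
    rw [Finset.sum_congr rfl fun p _ => (integral_finsetSum _ fun q _ =>
      (hi _ _).const_mul _).symm]
    rw [← integral_finsetSum _ fun p _ => integrable_finsetSum _ fun q _ => (hi _ _).const_mul _]
    refine integral_congr_ae (ae_of_all _ fun x => ?_)
    simp only
    push_cast
    rw [← Complex.mul_conj', map_sum, Finset.sum_mul_sum, Finset.mul_sum]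
    refine Finset.sum_congr rfl fun p _ => ?_
    rw [Finset.mul_sum]
    refine Finset.sum_congr rfl fun q _ => ?_
    simp only [map_mul, map_pow, Complex.conj_ofReal]
    ring
  rw [h, integral_complex_ofReal, Complex.zero_le_real]
  refine integral_nonneg_of_ae ?_
  filter_upwards [hw] with x hx
  simp only [Pi.zero_apply]
  positivity

end Necessity

theorem isClosed_strip (R : ℝ) : IsClosed (strip R) :=
  isClosed_le (continuous_abs.comp continuous_snd) continuous_const

/-! ### The moment functional and construction of the measure -/

section Functional

open Polynomial

/-- The linear functional on the polynomials in two variables with moments `s`; the inner variable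
is `x₁` and the outer one is `x₂`. -/
noncomputable def momentFunctional (s : ℕ → ℕ → ℂ) : ℝ[X][X] →ₗ[ℝ] ℂ :=
  lsum fun n => lsum fun m => LinearMap.toSpanSingleton ℝ ℂ (s m n)

theorem momentFunctional_monomial (s : ℕ → ℕ → ℂ) (m n : ℕ) (c : ℝ) :
    momentFunctional s (monomial n (monomial m c)) = c * s m n := by
  simp [momentFunctional, sum_monomial_index]

theorem momentFunctional_weight_mul (s : ℕ → ℕ → ℂ) (R : ℝ) (q : ℝ[X][X]) :
    momentFunctional s ((C (C (R ^ 2)) - X ^ 2) * q) =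
      momentFunctional (fun m n => (R : ℂ) ^ 2 * s m n - s m (n + 2)) q := by
  induction q using Polynomial.induction_on' with
  | add p q hp hq => rw [mul_add, map_add, map_add, hp, hq]
  | monomial n p =>
    induction p using Polynomial.induction_on' with
    | add p q hp hq => rw [map_add, mul_add, map_add, map_add, hp, hq]
    | monomial m c =>
      have : (C (C (R ^ 2)) - X ^ 2) * monomial n (monomial m c) =
          monomial n (monomial m (R ^ 2 * c)) - monomial (n + 2) (monomial m c) := by
        rw [sub_mul, C_mul_monomial, C_mul_monomial, X_pow_mul_monomial]
      rw [this, map_sub, momentFunctional_monomial, momentFunctional_monomial,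
        momentFunctional_monomial]
      push_cast; ring

theorem Polynomial.exists_eq_sum_monomial_monomial (p : ℝ[X][X]) :
    ∃ α : ℕ × ℕ →₀ ℝ, p = ∑ a ∈ α.support, monomial a.2 (monomial a.1 (α a)) := by
  suffices h : ∃ α : ℕ × ℕ →₀ ℝ, p = α.sum fun a c => monomial a.2 (monomial a.1 c) from h
  induction p using Polynomial.induction_on' with
  | add p q hp hq =>
    obtain ⟨α, rfl⟩ := hp
    obtain ⟨β, rfl⟩ := hq
    exact ⟨α + β, (Finsupp.sum_add_index' (by simp) (by simp)).symm⟩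
  | monomial n p =>
    induction p using Polynomial.induction_on' with
    | add p q hp hq =>
      obtain ⟨α, hα⟩ := hp
      obtain ⟨β, hβ⟩ := hq
      exact ⟨α + β, by rw [map_add, hα, hβ, Finsupp.sum_add_index' (by simp) (by simp)]⟩
    | monomial m c => exact ⟨Finsupp.single (m, n) c, by simp [Finsupp.sum_single_index]⟩

/-- Only families with real coefficients are needed here. -/
theorem momentFunctional_sq_nonneg {s : ℕ → ℕ → ℂ}
    (hs : ∀ α : ℕ × ℕ →₀ ℂ, 0 ≤ ∑ p ∈ α.support, ∑ q ∈ α.support,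
      α p * conj (α q) * s (p.1 + q.1) (p.2 + q.2)) (f : ℝ[X][X]) :
    0 ≤ momentFunctional s (f ^ 2) := by
  obtain ⟨α, rfl⟩ := f.exists_eq_sum_monomial_monomial
  have h := hs (α.mapRange (fun c : ℝ => (c : ℂ)) Complex.ofReal_zero)
  rw [Finsupp.support_mapRange_of_injective _ _ Complex.ofReal_injective] at h
  rw [sq, Finset.sum_mul_sum, map_sum]
  refine h.trans_eq (Finset.sum_congr rfl fun p _ => ?_)
  rw [map_sum]
  refine Finset.sum_congr rfl fun q _ => ?_
  rw [monomial_mul_monomial, monomial_mul_monomial, momentFunctional_monomial]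
  simp

theorem momentFunctional_im_eq_zero {s : ℕ → ℕ → ℂ}
    (hs : ∀ f, 0 ≤ momentFunctional s (f ^ 2)) (f : ℝ[X][X]) :
    (momentFunctional s f).im = 0 := by
  have h : (4 : ℝ) • f = (f + 1) ^ 2 - (f - 1) ^ 2 := by
    rw [Algebra.smul_def, map_ofNat]; ring
  have h1 := congrArg (fun q => (momentFunctional s q).im) h
  have e : ∀ q, (momentFunctional s (q ^ 2)).im = 0 := fun q => (Complex.nonneg_iff.1 (hs q)).2.symm
  simpa [e] using h1

theorem exists_isStripMomentSolution {R : ℝ} (hR : 0 < R) {s : ℕ → ℕ → ℂ}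
    (h1 : ∀ f, 0 ≤ momentFunctional s (f ^ 2))
    (h2 : ∀ f, 0 ≤ momentFunctional s ((C (C (R ^ 2)) - X ^ 2) * f ^ 2)) :
    ∃ μ, IsStripMomentSolution R s μ := by
  let L : ℝ[X][X] →ₗ[ℝ] ℝ := Complex.reLm.comp (momentFunctional s)
  have hL : ∀ p, L p = (momentFunctional s p).re := fun p => rfl
  let φ : ℝ[X][X] →ₐ[ℝ] C(strip R, ℝ) :=
    aevalAeval ⟨fun x => x.1.1, by fun_prop⟩ ⟨fun x => x.1.2, by fun_prop⟩
  have hφ : ∀ p x, φ p x = (p.eval (C x.1.2)).eval x.1.1 := by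
    intro p x
    induction p using Polynomial.induction_on' with
    | add p q hp hq => simp only [map_add, ContinuousMap.add_apply, hp, hq, eval_add]
    | monomial n p =>
      induction p using Polynomial.induction_on' with
      | add p q hp hq => simp only [map_add, ContinuousMap.add_apply, hp, hq, eval_add]
      | monomial m c => simp [φ, ← C_mul_X_pow_eq_monomial]
  have := (isClosed_strip R).locallyCompactSpace
  -- The function x₁² is proper on the strip, as x₂ is bounded there.
  obtain ⟨μ, hμ⟩ := exists_measure_integral_eq (φ := φ) (h := C (X ^ 2)) (L := L)
    (fun x => by rw [hφ]; simp; positivity) (fun c => by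
      have hK : IsCompact (Set.Icc (-√c) √c ×ˢ Set.Icc (-R) R) := isCompact_Icc.prod isCompact_Icc
      refine ((isClosed_strip R).isClosedEmbedding_subtypeVal.isCompact_preimage hK).of_isClosed_subset
        (isClosed_le (φ _).continuous continuous_const) fun x hx => ?_
      have hx' : x.1.1 ^ 2 ≤ c := by
        have : φ (C (X ^ 2)) x ≤ c := hx
        rw [hφ] at this; simpa using this
      exact ⟨abs_le.1 (Real.abs_le_sqrt hx'), abs_le.1 x.2⟩)
    (fun p hp => map_nonneg_of_nonneg_on_strip hR
      (fun f => (Complex.nonneg_iff.1 (h1 f)).1) (fun f => (Complex.nonneg_iff.1 (h2 f)).1)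
      fun x t ht => by simpa only [hφ] using hp ⟨(x, t), ht⟩)
  have hemb : MeasurableEmbedding (Subtype.val : strip R → ℝ × ℝ) :=
    MeasurableEmbedding.subtype_coe (isClosed_strip R).measurableSet
  have hrestr : (μ.map Subtype.val).restrict (strip R) = μ.map Subtype.val := by
    rw [hemb.restrict_map]; simp
  have hmon : ∀ (m n : ℕ) (x : strip R), ((x.1.1 : ℂ) ^ m * (x.1.2 : ℂ) ^ n) =
      ((φ (monomial n (monomial m 1)) x : ℝ) : ℂ) := fun m n x => by
    rw [hφ]; simp
  refine ⟨μ.map Subtype.val, ?_, fun m n => ?_, fun m n => ?_⟩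
  · rw [hemb.map_apply]; simp
  · rw [MeasureTheory.IntegrableOn, hrestr, hemb.integrable_map_iff]
    refine ((hμ (monomial n (monomial m 1))).1.ofReal (𝕜 := ℂ)).congr
      (MeasureTheory.ae_of_all _ fun x => (hmon m n x).symm)
  · rw [hrestr, hemb.integral_map, MeasureTheory.integral_congr_ae
      (MeasureTheory.ae_of_all _ (hmon m n)), integral_complex_ofReal, (hμ _).2, hL]
    apply Complex.ext
    · simp [momentFunctional_monomial]
    · have := momentFunctional_im_eq_zero h1 (monomial n (monomial m 1))
      rw [momentFunctional_monomial] at this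
      simpa using this.symm

end Functional

/- The inequality `0 ≤ z` for a complex number `z` means that `z` is real and non-negative. -/
theorem theorem2p2 (R : ℝ) (hR : 0 < R) (s : ℕ → ℕ → ℂ) :
    (∃ μ : MeasureTheory.Measure (ℝ × ℝ), IsStripMomentSolution R s μ) ↔
      ((∀ α : ℕ × ℕ →₀ ℂ,
          0 ≤ ∑ p ∈ α.support, ∑ q ∈ α.support,
            α p * conj (α q) * s (p.1 + q.1) (p.2 + q.2)) ∧
        (∀ α : ℕ × ℕ →₀ ℂ,
          0 ≤ ∑ p ∈ α.support, ∑ q ∈ α.support,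
            α p * conj (α q) *
              ((R : ℂ) ^ 2 * s (p.1 + q.1) (p.2 + q.2) - s (p.1 + q.1) (p.2 + q.2 + 2)))) := by
  constructor
  · rintro ⟨μ, hμ⟩
    refine ⟨sum_mul_conj_mul_nonneg_of_integral (μ := μ.restrict (strip R)) (w := fun _ => 1)
        (by simp) (fun m n => ?_) (fun m n => ?_),
      sum_mul_conj_mul_nonneg_of_integral (μ := μ.restrict (strip R))
        (w := fun x => R ^ 2 - x.2 ^ 2)
        (s := fun m n => (R : ℂ) ^ 2 * s m n - s m (n + 2)) ?_ (fun m n => ?_) (fun m n => ?_)⟩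
    · simpa [MeasureTheory.IntegrableOn] using hμ.integrable m n
    · simpa using hμ.moment m n
    · filter_upwards [MeasureTheory.ae_restrict_mem (isClosed_strip R).measurableSet] with x hx
      exact sub_nonneg.2 (sq_le_sq' (abs_le.1 hx).1 (abs_le.1 hx).2)
    · refine (((hμ.integrable m n).const_mul ((R : ℂ) ^ 2)).sub (hμ.integrable m (n + 2))).congr
        (MeasureTheory.ae_of_all _ fun x => ?_)
      simp only [Pi.sub_apply]
      push_cast; ring
    · rw [← hμ.moment, ← hμ.moment, ← MeasureTheory.integral_const_mul,
        ← MeasureTheory.integral_sub ((hμ.integrable m n).const_mul _) (hμ.integrable m (n + 2))]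
      congr 1
      ext x
      push_cast; ring
  · rintro ⟨h1, h2⟩
    refine exists_isStripMomentSolution hR (momentFunctional_sq_nonneg h1) fun f => ?_
    rw [momentFunctional_weight_mul]
    exact momentFunctional_sq_nonneg
      (s := fun m n => (R : ℂ) ^ 2 * s m n - s m (n + 2)) h2 f
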